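/- Let $|p\rangle,|q\rangle,|1\rangle,|2\rangle$ be an orthonormal basis of Alice's space $\mathbb{C}^4$, and let Bob's space $\mathbb{C}^3$ and Charlie's space $\mathbb{C}^3$ have orthonormal bases $|p\rangle,|q\rangle,|1\rangle$ and $|p\rangle,|q\rangle,|2\rangle$, respectively. Put $|\epsilon_\pm\rangle=\frac{1}{\sqrt2}(|p\rangle\pm|q\rangle)$ and $|\gamma^i_\pm\rangle=\frac1{\sqrt2}(|q\rangle\pm|i\rangle)$ for $i\in\{1,2\}$, and let $\mathbb{G}_3\subset\mathbb{C}^4\otimes\mathbb{C}^3\otimes\mathbb{C}^3$ be the set of the fourteen product states $$|\epsilon_\pm\rangle|1\rangle|2\rangle,\quad |1\rangle|\gamma^1_\pm\rangle|2\rangle,\quad |\gamma^1_\pm\rangle|p\rangle|2\rangle,\quad |p\rangle|\epsilon_\pm\rangle|2\rangle,\quad |2\rangle|1\rangle|\gamma^2_\pm\rangle,\quad |\gamma^2_\pm\rangle|1\rangle|p\rangle,\quad |p\rangle|1\rangle|\epsilon_\pm\rangle .$$ In the task $\tau_3$, a state drawn from $\mathbb{G}_3$ according to a known probability distribution that gives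 every element positive probability (for instance the uniform one) is distributed to Alice, Bob and Charlie, who have to identify it by local operations and classical communication (LOCC), assisted by one copy of a resource state that they share. The payoff $\mathcal{P}_{\tau_3}(\rho)$ of a resource state $\rho$ is the supremum, over all LOCC protocols with finitely many rounds, of the probability of identifying the state correctly, and $\rho\succ_{\tau_3}\sigma$ means $\mathcal{P}_{\tau_3}(\rho)>\mathcal{P}_{\tau_3}(\sigma)$. Then, for the three-qubit GHZ state $|g_3\rangle=\frac{1}{\sqrt2}(|000\rangle+|111\rangle)$ shared by the three parties, for all $d_1,d_2$ and every density operator $\rho$ on $\mathbb{C}^{d_1}\otimes\mathbb{C}^{d_2}$ shared by any two of the three parties, one has $|g_3\rangle\succ_{\tau_3}\rho$. -/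

import Mathlib

open scoped Matrix BigOperators ComplexOrder

noncomputable section

namespace LSD

/-! Finite-dimensional quantum systems: a system with finite basis `A` has Hilbert space `ℂ^A`,
and its operators are matrices indexed by `A`. -/

/-- The computational basis vector `|i⟩`. -/
def ket {A : Type} [DecidableEq A] (i : A) : A → ℂ := Pi.single i 1

/-- The sign `+` (for `true`) or `-` (for `false`). -/
def sgn (s : Bool) : ℂ := if s then 1 else -1

/-- `(|i⟩ ± |j⟩) / √2`. -/
def pm {A : Type} [DecidableEq A] (i j : A) (s : Bool) : A → ℂ :=
  ((Real.sqrt 2 : ℝ) : ℂ)⁻¹ • (ket i + sgn s • ket j)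

/-- The product vector `|a⟩ ⊗ |b⟩ ⊗ |c⟩`. -/
def prod3 {A B C : Type} (a : A → ℂ) (b : B → ℂ) (c : C → ℂ) : A × B × C → ℂ :=
  fun x => a x.1 * b x.2.1 * c x.2.2

/-- The projector `|ψ⟩⟨ψ|`. -/
def proj {A : Type} (ψ : A → ℂ) : Matrix A A ℂ := Matrix.vecMulVec ψ (star ψ)

/-- Density operators. -/
def IsDensity {A : Type} [Fintype A] (ρ : Matrix A A ℂ) : Prop :=
  ρ.PosSemidef ∧ ρ.trace = 1

/-! ### LOCC protocols -/

open Classical in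
/-- A family of Kraus operators, one for each outcome, is a quantum measurement:
`∑ₖ Kₖ† Kₖ = 1`. The output system may differ from the input system, so that appending,
discarding and transforming local ancillas, as well as drawing random numbers, are included. -/
def IsMeasurement {κ A A' : Type} [Fintype κ] [Fintype A'] (K : κ → Matrix A' A ℂ) : Prop :=
  ∑ k, (K k)ᴴ * K k = 1

/-- Three-party finite-round LOCC protocols that end by announcing an element of `Ω`; the local
systems of the parties are currently `A`, `B`, `C`. In each step one party measures its own system
and broadcasts the outcome, on which everything that follows may depend. -/
inductive LOCC (Ω : Type) : Type → Type → Type → Type 1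
  | announce {A B C : Type} (ω : Ω) : LOCC Ω A B C
  | alice {A B C : Type} (κ A' : Type) [Fintype κ] [Fintype A'] (K : κ → Matrix A' A ℂ)
      (hK : IsMeasurement K) (next : κ → LOCC Ω A' B C) : LOCC Ω A B C
  | bob {A B C : Type} (κ B' : Type) [Fintype κ] [Fintype B'] (K : κ → Matrix B' B ℂ)
      (hK : IsMeasurement K) (next : κ → LOCC Ω A B' C) : LOCC Ω A B C
  | charlie {A B C : Type} (κ C' : Type) [Fintype κ] [Fintype C'] (K : κ → Matrix C' C ℂ)
      (hK : IsMeasurement K) (next : κ → LOCC Ω A B C') : LOCC Ω A B C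

/-- `(K ⊗ 1 ⊗ 1) σ (K ⊗ 1 ⊗ 1)†`. -/
def actA {A B C A' : Type} [Fintype A] (K : Matrix A' A ℂ)
    (σ : Matrix (A × B × C) (A × B × C) ℂ) : Matrix (A' × B × C) (A' × B × C) ℂ :=
  fun x y => ∑ u, ∑ v, K x.1 u * σ (u, x.2.1, x.2.2) (v, y.2.1, y.2.2) * star (K y.1 v)

/-- `(1 ⊗ K ⊗ 1) σ (1 ⊗ K ⊗ 1)†`. -/
def actB {A B C B' : Type} [Fintype B] (K : Matrix B' B ℂ)
    (σ : Matrix (A × B × C) (A × B × C) ℂ) : Matrix (A × B' × C) (A × B' × C) ℂ :=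
  fun x y => ∑ u, ∑ v, K x.2.1 u * σ (x.1, u, x.2.2) (y.1, v, y.2.2) * star (K y.2.1 v)

/-- `(1 ⊗ 1 ⊗ K) σ (1 ⊗ 1 ⊗ K)†`. -/
def actC {A B C C' : Type} [Fintype C] (K : Matrix C' C ℂ)
    (σ : Matrix (A × B × C) (A × B × C) ℂ) : Matrix (A × B × C') (A × B × C') ℂ :=
  fun x y => ∑ u, ∑ v, K x.2.2 u * σ (x.1, x.2.1, u) (y.1, y.2.1, v) * star (K y.2.2 v)

open Classical in
/-- The probability that the protocol, run on the (possibly subnormalized) state `σ`,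
announces `ω`. -/
def LOCC.prob {Ω : Type} (ω : Ω) {A B C : Type} (P : LOCC Ω A B C)
    [Fintype A] [Fintype B] [Fintype C] (σ : Matrix (A × B × C) (A × B × C) ℂ) : ℝ :=
  match P with
  | .announce ω' => if ω' = ω then σ.trace.re else 0
  | @LOCC.alice _ _ _ _ _ _ _ _ K _ next => ∑ k, (next k).prob ω (actA (K k) σ)
  | @LOCC.bob _ _ _ _ _ _ _ _ K _ next => ∑ k, (next k).prob ω (actB (K k) σ)
  | @LOCC.charlie _ _ _ _ _ _ _ _ K _ next => ∑ k, (next k).prob ω (actC (K k) σ)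

/-! ### The discrimination task -/

/-- Labels of the fourteen states: seven pairs `±`. -/
abbrev Label : Type := Fin 7 × Bool

/-- The set `𝔾₃ ⊂ ℂ⁴ ⊗ ℂ³ ⊗ ℂ³`. Alice's basis `|p⟩, |q⟩, |1⟩, |2⟩` is `0, 1, 2, 3`;
Bob's basis `|p⟩, |q⟩, |1⟩` and Charlie's basis `|p⟩, |q⟩, |2⟩` are both `0, 1, 2`. -/
def zeta : Label → Fin 4 × Fin 3 × Fin 3 → ℂ
  | (0, s) => prod3 (pm 0 1 s) (ket 2) (ket 2)
  | (1, s) => prod3 (ket 2) (pm 1 2 s) (ket 2)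
  | (2, s) => prod3 (pm 1 2 s) (ket 0) (ket 2)
  | (3, s) => prod3 (ket 0) (pm 0 1 s) (ket 2)
  | (4, s) => prod3 (ket 3) (ket 2) (pm 1 2 s)
  | (5, s) => prod3 (pm 1 3 s) (ket 2) (ket 0)
  | (6, s) => prod3 (ket 0) (ket 2) (pm 0 1 s)

/-- The product of a state `σ` of the systems to be discriminated and a resource state `ρ`, each
party holding its part of both. -/
def withResource {A B C RA RB RC : Type} (σ : Matrix (A × B × C) (A × B × C) ℂ)
    (ρ : Matrix (RA × RB × RC) (RA × RB × RC) ℂ) :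
    Matrix ((A × RA) × (B × RB) × (C × RC)) ((A × RA) × (B × RB) × (C × RC)) ℂ :=
  fun x y =>
    σ (x.1.1, x.2.1.1, x.2.2.1) (y.1.1, y.2.1.1, y.2.2.1) *
      ρ (x.1.2, x.2.1.2, x.2.2.2) (y.1.2, y.2.1.2, y.2.2.2)

/-- Probability of identifying the state correctly, when it is `ζᵢ` with probability `p i`, the
parties share the resource `ρ` and they follow the protocol `P`. -/
def success {RA RB RC : Type} [Fintype RA] [Fintype RB] [Fintype RC] (p : Label → ℝ)
    (ρ : Matrix (RA × RB × RC) (RA × RB × RC) ℂ)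
    (P : LOCC Label (Fin 4 × RA) (Fin 3 × RB) (Fin 3 × RC)) : ℝ :=
  ∑ i, p i * P.prob i (withResource (proj (zeta i)) ρ)

/-- The payoff of the resource `ρ` in the task: the optimal (supremal) success probability over all
LOCC protocols, of any number of rounds. -/
def payoff {RA RB RC : Type} [Fintype RA] [Fintype RB] [Fintype RC] (p : Label → ℝ)
    (ρ : Matrix (RA × RB × RC) (RA × RB × RC) ℂ) : ℝ :=
  ⨆ P : LOCC Label (Fin 4 × RA) (Fin 3 × RB) (Fin 3 × RC), success p ρ P

/-- `ρ ≻ σ` in the task of discriminating `𝔾₃` with prior `p`. -/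
def StrictlyBetter {RA RB RC SA SB SC : Type} [Fintype RA] [Fintype RB] [Fintype RC]
    [Fintype SA] [Fintype SB] [Fintype SC] (p : Label → ℝ)
    (ρ : Matrix (RA × RB × RC) (RA × RB × RC) ℂ)
    (σ : Matrix (SA × SB × SC) (SA × SB × SC) ℂ) : Prop :=
  payoff p σ < payoff p ρ

/-! ### Resource states -/

/-- The GHZ vector `(|000⟩ + |111⟩) / √2`. -/
def ghz : Fin 2 × Fin 2 × Fin 2 → ℂ :=
  ((Real.sqrt 2 : ℝ) : ℂ)⁻¹ • (ket (0, 0, 0) + ket (1, 1, 1))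

/-- The two-party state `ρ` held by Alice and Bob; Charlie has a trivial resource system. -/
def sharedAB {D E : Type} (ρ : Matrix (D × E) (D × E) ℂ) :
    Matrix (D × E × Unit) (D × E × Unit) ℂ :=
  fun x y => ρ (x.1, x.2.1) (y.1, y.2.1)

/-- The two-party state `ρ` held by Bob and Charlie. -/
def sharedBC {D E : Type} (ρ : Matrix (D × E) (D × E) ℂ) :
    Matrix (Unit × D × E) (Unit × D × E) ℂ :=
  fun x y => ρ (x.2.1, x.2.2) (y.2.1, y.2.2)

/-- The two-party state `ρ` held by Alice and Charlie. -/
def sharedAC {D E : Type} (ρ : Matrix (D × E) (D × E) ℂ) :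
    Matrix (D × Unit × E) (D × Unit × E) ℂ :=
  fun x y => ρ (x.1, x.2.2) (y.1, y.2.2)

end LSD

end

/-!
Across the cut between the two holders of a bipartite resource and the third party, `𝔾₃` contains
the domino states of Bennett et al. (without the middle one) on three basis vectors of each side.
Local operations act on these states through the basis vectors, of which we only follow the squared
norms. A potential of these norms is subadditive under measurements, by Cauchy–Schwarz, is positive
at the start, and at an announcement is at most four times the total weight of the domino states
other than the announced one. Hence the probability of failure has a positive lower bound that does
not depend on the protocol.

With the GHZ state, Alice announces the parity of her qubit and of being outside `|p⟩`. This copies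
the information whether she is in `|p⟩` coherently to the qubits of Bob and Charlie, who use it in
the measurements that reveal the pair without disturbing the state. Its sign is then an eigenvalue
of a product of three local involutions.
-/

open scoped Matrix BigOperators ComplexOrder

noncomputable section

namespace LSD

/-! ### Squared norms and local maps -/

section LocalMaps

variable {X Y Z κ : Type*}

/-- The product vector `|α⟩ ⊗ |β⟩` of two systems. -/
def tensor (α : X → ℂ) (β : Y → ℂ) : X × Y → ℂ := fun x => α x.1 * β x.2

/-- `L ⊗ 1`, the action of `L` on the first of two systems. -/
def onFst (L : (X → ℂ) →ₗ[ℂ] (Y → ℂ)) : (X × Z → ℂ) →ₗ[ℂ] (Y × Z → ℂ) where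
  toFun ψ y := L (fun x => ψ (x, y.2)) y.1
  map_add' _ _ := funext fun y => congrFun (L.map_add _ _) y.1
  map_smul' c _ := funext fun y => congrFun (L.map_smul c _) y.1

/-- `1 ⊗ L`, the action of `L` on the second of two systems. -/
def onSnd (L : (X → ℂ) →ₗ[ℂ] (Y → ℂ)) : (Z × X → ℂ) →ₗ[ℂ] (Z × Y → ℂ) where
  toFun ψ y := L (fun x => ψ (y.1, x)) y.2
  map_add' _ _ := funext fun y => congrFun (L.map_add _ _) y.2
  map_smul' c _ := funext fun y => congrFun (L.map_smul c _) y.2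

lemma onFst_tensor (L : (X → ℂ) →ₗ[ℂ] (Y → ℂ)) (α : X → ℂ) (β : Z → ℂ) :
    onFst L (tensor α β) = tensor (L α) β := by
  ext ⟨y, z⟩
  have h : (fun x => α x * β z) = β z • α := funext fun x => mul_comm _ _
  simp [onFst, tensor, h, mul_comm]

lemma onSnd_tensor (L : (X → ℂ) →ₗ[ℂ] (Y → ℂ)) (α : Z → ℂ) (β : X → ℂ) :
    onSnd L (tensor α β) = tensor α (L β) :=
  funext fun y => congrFun (L.map_smul (α y.1) β) y.2

variable [Fintype X] [Fintype Y] [Fintype Z] [Fintype κ]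

/-- The squared `ℓ²` norm, the probability carried by a subnormalized state. (Mathlib's norm on
`X → ℂ` is the supremum norm.) -/
def sqNorm (ψ : X → ℂ) : ℝ := ∑ x, Complex.normSq (ψ x)

lemma sqNorm_nonneg (ψ : X → ℂ) : 0 ≤ sqNorm ψ :=
  Finset.sum_nonneg fun _ _ => Complex.normSq_nonneg _

@[simp] lemma sqNorm_zero : sqNorm (0 : X → ℂ) = 0 := by simp [sqNorm]

lemma ofReal_sqNorm (ψ : X → ℂ) : (sqNorm ψ : ℂ) = star ψ ⬝ᵥ ψ := by
  simp [sqNorm, dotProduct, Complex.normSq_eq_conj_mul_self]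

lemma sqNorm_comp_equiv (ψ : Y → ℂ) (e : X ≃ Y) : sqNorm (ψ ∘ e) = sqNorm ψ :=
  e.sum_comp fun y => Complex.normSq (ψ y)

lemma sqNorm_tensor (α : X → ℂ) (β : Y → ℂ) : sqNorm (tensor α β) = sqNorm α * sqNorm β := by
  simp [sqNorm, tensor, Fintype.sum_prod_type, Finset.sum_mul_sum]

/-- The maps `L k` are the branches of a measurement: their squared norms add up to that of the
input. -/
def PreservesSqNorm (L : κ → (X → ℂ) →ₗ[ℂ] (Y → ℂ)) : Prop :=
  ∀ ψ, ∑ k, sqNorm (L k ψ) = sqNorm ψ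

lemma PreservesSqNorm.onFst {L : κ → (X → ℂ) →ₗ[ℂ] (Y → ℂ)} (hL : PreservesSqNorm L) :
    PreservesSqNorm fun k => onFst (Z := Z) (L k) := fun ψ => by
  simp only [sqNorm, Fintype.sum_prod_type_right]
  rw [Finset.sum_comm]
  exact Finset.sum_congr rfl fun z _ => hL fun x => ψ (x, z)

lemma PreservesSqNorm.onSnd {L : κ → (X → ℂ) →ₗ[ℂ] (Y → ℂ)} (hL : PreservesSqNorm L) :
    PreservesSqNorm fun k => onSnd (Z := Z) (L k) := fun ψ => by
  simp only [sqNorm, Fintype.sum_prod_type]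
  rw [Finset.sum_comm]
  exact Finset.sum_congr rfl fun z _ => hL fun x => ψ (z, x)

end LocalMaps

lemma IsMeasurement.preservesSqNorm {κ A A' : Type} [Fintype κ] [Fintype A] [Fintype A']
    {K : κ → Matrix A' A ℂ} (hK : IsMeasurement K) :
    PreservesSqNorm fun k => (K k).mulVecLin := fun ψ => by
  classical
  have hK' : ∑ k, (K k)ᴴ * K k = 1 := by rw [hK]
  apply Complex.ofReal_injective
  calc ((∑ k, sqNorm ((K k).mulVecLin ψ) : ℝ) : ℂ)
      = ∑ k, star ψ ⬝ᵥ ((K k)ᴴ * K k) *ᵥ ψ := by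
        simp only [Complex.ofReal_sum, ofReal_sqNorm, Matrix.mulVecLin_apply, Matrix.star_mulVec,
          ← Matrix.dotProduct_mulVec, Matrix.mulVec_mulVec]
    _ = sqNorm ψ := by
        rw [← dotProduct_sum, ← Matrix.sum_mulVec, hK', Matrix.one_mulVec, ofReal_sqNorm]

/-! ### Protocols on pure states -/

section PureStates

variable {Ω ι A B C A' B' C' : Type}

lemma trace_proj [Fintype A] (ψ : A → ℂ) : (proj ψ).trace.re = sqNorm ψ := by
  simp [proj, sqNorm, Matrix.trace, Matrix.vecMulVec_apply, Complex.normSq_apply]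

lemma actA_sum_proj [Fintype ι] [Fintype A] (K : Matrix A' A ℂ) (ψ : ι → A × B × C → ℂ) :
    actA K (∑ l, proj (ψ l)) = ∑ l, proj (onFst K.mulVecLin (ψ l)) := by
  ext x y
  simp only [actA, proj, onFst, Matrix.sum_apply, Matrix.vecMulVec_apply, Pi.star_apply,
    LinearMap.coe_mk, AddHom.coe_mk, Matrix.mulVecLin_apply, Matrix.mulVec, dotProduct, star_sum,
    star_mul', Finset.mul_sum, Finset.sum_mul]
  rw [Finset.sum_comm]
  conv_rhs => rw [Finset.sum_comm]; enter [2, v]; rw [Finset.sum_comm]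
  exact Finset.sum_congr rfl fun _ _ => Finset.sum_congr rfl fun _ _ =>
    Finset.sum_congr rfl fun _ _ => by ring

lemma actB_sum_proj [Fintype ι] [Fintype B] (K : Matrix B' B ℂ) (ψ : ι → A × B × C → ℂ) :
    actB K (∑ l, proj (ψ l)) = ∑ l, proj (onSnd (onFst K.mulVecLin) (ψ l)) := by
  ext x y
  simp only [actB, proj, onFst, onSnd, Matrix.sum_apply, Matrix.vecMulVec_apply, Pi.star_apply,
    LinearMap.coe_mk, AddHom.coe_mk, Matrix.mulVecLin_apply, Matrix.mulVec, dotProduct, star_sum,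
    star_mul', Finset.mul_sum, Finset.sum_mul]
  rw [Finset.sum_comm]
  conv_rhs => rw [Finset.sum_comm]; enter [2, v]; rw [Finset.sum_comm]
  exact Finset.sum_congr rfl fun _ _ => Finset.sum_congr rfl fun _ _ =>
    Finset.sum_congr rfl fun _ _ => by ring

lemma actC_sum_proj [Fintype ι] [Fintype C] (K : Matrix C' C ℂ) (ψ : ι → A × B × C → ℂ) :
    actC K (∑ l, proj (ψ l)) = ∑ l, proj (onSnd (onSnd K.mulVecLin) (ψ l)) := by
  ext x y
  simp only [actC, proj, onSnd, Matrix.sum_apply, Matrix.vecMulVec_apply, Pi.star_apply,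
    LinearMap.coe_mk, AddHom.coe_mk, Matrix.mulVecLin_apply, Matrix.mulVec, dotProduct, star_sum,
    star_mul', Finset.mul_sum, Finset.sum_mul]
  rw [Finset.sum_comm]
  conv_rhs => rw [Finset.sum_comm]; enter [2, v]; rw [Finset.sum_comm]
  exact Finset.sum_congr rfl fun _ _ => Finset.sum_congr rfl fun _ _ =>
    Finset.sum_congr rfl fun _ _ => by ring

open Classical in
/-- `LOCC.prob` on a pure state, computed with state vectors instead of density operators. -/
def LOCC.pureProb (ω : Ω) {A B C : Type} (P : LOCC Ω A B C) [Fintype A] [Fintype B] [Fintype C]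
    (ψ : A × B × C → ℂ) : ℝ :=
  match P with
  | .announce ω' => if ω' = ω then sqNorm ψ else 0
  | @LOCC.alice _ _ _ _ _ _ _ _ K _ next =>
      ∑ k, (next k).pureProb ω (onFst (K k).mulVecLin ψ)
  | @LOCC.bob _ _ _ _ _ _ _ _ K _ next =>
      ∑ k, (next k).pureProb ω (onSnd (onFst (K k).mulVecLin) ψ)
  | @LOCC.charlie _ _ _ _ _ _ _ _ K _ next =>
      ∑ k, (next k).pureProb ω (onSnd (onSnd (K k).mulVecLin) ψ)

theorem LOCC.prob_sum_proj [Fintype ι] (ω : Ω) (P : LOCC Ω A B C) :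
    ∀ [Fintype A] [Fintype B] [Fintype C] (ψ : ι → A × B × C → ℂ),
      P.prob ω (∑ l, proj (ψ l)) = ∑ l, P.pureProb ω (ψ l) := by
  induction P with
  | announce ω' =>
    intro _ _ _ ψ
    simp only [LOCC.prob, LOCC.pureProb]
    split_ifs <;> simp [Matrix.trace_sum, trace_proj]
  | alice κ A' K hK next ih =>
    intro _ _ _ ψ
    simp only [LOCC.prob, LOCC.pureProb, actA_sum_proj, ih]
    exact Finset.sum_comm
  | bob κ B' K hK next ih =>
    intro _ _ _ ψ
    simp only [LOCC.prob, LOCC.pureProb, actB_sum_proj, ih]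
    exact Finset.sum_comm
  | charlie κ C' K hK next ih =>
    intro _ _ _ ψ
    simp only [LOCC.prob, LOCC.pureProb, actC_sum_proj, ih]
    exact Finset.sum_comm

lemma LOCC.pureProb_mem_Icc (ω : Ω) (P : LOCC Ω A B C) :
    ∀ [Fintype A] [Fintype B] [Fintype C] (ψ : A × B × C → ℂ),
      P.pureProb ω ψ ∈ Set.Icc 0 (sqNorm ψ) := by
  have sum_mem : ∀ {κ : Type} [Fintype κ] {f g : κ → ℝ}, (∀ k, f k ∈ Set.Icc 0 (g k)) →
      ∑ k, f k ∈ Set.Icc 0 (∑ k, g k) := fun h =>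
    ⟨Finset.sum_nonneg fun k _ => (h k).1, Finset.sum_le_sum fun k _ => (h k).2⟩
  induction P with
  | announce ω' =>
    intro _ _ _ ψ
    simp only [LOCC.pureProb]
    split_ifs <;> simp [sqNorm_nonneg]
  | alice κ A' K hK next ih =>
    intro _ _ _ ψ
    rw [← hK.preservesSqNorm.onFst ψ]
    exact sum_mem fun k => ih k _
  | bob κ B' K hK next ih =>
    intro _ _ _ ψ
    rw [← hK.preservesSqNorm.onFst.onSnd ψ]
    exact sum_mem fun k => ih k _
  | charlie κ C' K hK next ih =>
    intro _ _ _ ψ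
    rw [← hK.preservesSqNorm.onSnd.onSnd ψ]
    exact sum_mem fun k => ih k _

end PureStates

/-! ### The potential of a pair of weight vectors -/

section Potential

/-- The relative imbalance of two nonnegative weights; division by zero makes it `0` when both
weights vanish, which is the value wanted. -/
def imbalance (u v : ℝ) : ℝ := (u - v) ^ 2 / (u + v)

lemma imbalance_comm (u v : ℝ) : imbalance u v = imbalance v u := by
  rw [imbalance, imbalance, ← neg_sub, neg_sq, add_comm]

lemma imbalance_nonneg {u v : ℝ} (hu : 0 ≤ u) (hv : 0 ≤ v) : 0 ≤ imbalance u v := by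
  unfold imbalance; positivity

lemma imbalance_mul_add {u v : ℝ} (hu : 0 ≤ u) (hv : 0 ≤ v) :
    imbalance u v * (u + v) = (u - v) ^ 2 := by
  refine div_mul_cancel_of_imp fun h => ?_
  obtain ⟨rfl, rfl⟩ := (add_eq_zero_iff_of_nonneg hu hv).mp h
  simp

lemma imbalance_sum_le {κ : Type*} [Fintype κ] {u v : κ → ℝ} (hu : ∀ k, 0 ≤ u k)
    (hv : ∀ k, 0 ≤ v k) : imbalance (∑ k, u k) (∑ k, v k) ≤ ∑ k, imbalance (u k) (v k) := by
  have cauchy_schwarz := Finset.sum_sq_le_sum_mul_sum_of_sq_le_mul Finset.univ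
    (fun k _ => imbalance_nonneg (hu k) (hv k)) (fun k _ => add_nonneg (hu k) (hv k))
    (fun k _ => (imbalance_mul_add (hu k) (hv k)).ge)
  rw [Finset.sum_sub_distrib, Finset.sum_add_distrib] at cauchy_schwarz
  exact div_le_of_le_mul₀
    (add_nonneg (Finset.sum_nonneg fun k _ => hu k) (Finset.sum_nonneg fun k _ => hv k))
    (Finset.sum_nonneg fun k _ => imbalance_nonneg (hu k) (hv k)) cauchy_schwarz

lemma abs_sub_le_of_imbalance_le {u v X : ℝ} (hu : 0 ≤ u) (hv : 0 ≤ v) (huv : u + v ≤ X)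
    (h : imbalance u v ≤ X / 100) : |u - v| ≤ X / 10 := by
  refine abs_le_of_sq_le_sq ?_ (by linarith)
  calc (u - v) ^ 2 = imbalance u v * (u + v) := (imbalance_mul_add hu hv).symm
    _ ≤ X / 100 * X := by gcongr; linarith
    _ = (X / 10) ^ 2 := by ring

/-- The loss of orthogonality within the four pairs of domino states (see `domino`), when the
squared norms of the basis vectors of the two parties have become `x` and `y`. -/
def loss (x y : Fin 3 → ℝ) : ℝ :=
  y 2 * imbalance (x 0) (x 1) + x 2 * imbalance (y 1) (y 2) +
    y 0 * imbalance (x 1) (x 2) + x 0 * imbalance (y 0) (y 1)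

/-- No weight is smaller than a fifth of the total. -/
def Balanced (x : Fin 3 → ℝ) : Prop := ∀ i, ∑ j, x j ≤ 5 * x i

open Classical in
/-- The potential that bounds the failure of a protocol from below. At the start `loss` vanishes and
the bilinear term is what counts. If only one of the vectors is balanced, then `loss` exceeds the
bilinear term (`balanced_of_loss_lt`), so that cutting this term off where a vector is unbalanced
keeps the potential subadditive. -/
def potential (x y : Fin 3 → ℝ) : ℝ :=
  if Balanced x ∧ Balanced y then max (loss x y) ((∑ i, x i) * (∑ i, y i) / 500) else loss x y

variable {x y : Fin 3 → ℝ}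

lemma loss_comp_rev (x y : Fin 3 → ℝ) : loss y (x ∘ Fin.rev) = loss x y := by
  calc loss y (x ∘ Fin.rev) = x 0 * imbalance (y 0) (y 1) + y 2 * imbalance (x 1) (x 0) +
        x 2 * imbalance (y 1) (y 2) + y 0 * imbalance (x 2) (x 1) := rfl
    _ = loss x y := by
        rw [loss, imbalance_comm (x 1) (x 0), imbalance_comm (x 2) (x 1)]
        ring

lemma sum_comp_rev (x : Fin 3 → ℝ) : ∑ i, (x ∘ Fin.rev) i = ∑ i, x i :=
  Equiv.sum_comp Fin.revPerm x

lemma balanced_comp_rev : Balanced (x ∘ Fin.rev) ↔ Balanced x := by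
  simp only [Balanced, sum_comp_rev]
  exact (Fin.rev_surjective.forall (p := fun i => ∑ j, x j ≤ 5 * x i)).symm

lemma potential_comp_rev (x y : Fin 3 → ℝ) : potential y (x ∘ Fin.rev) = potential x y := by
  rw [potential, potential, loss_comp_rev, sum_comp_rev, balanced_comp_rev, mul_comm]
  congr 1
  exact propext and_comm

lemma balanced_of_imbalance_le (hx : ∀ i, 0 ≤ x i) (h₀₁ : imbalance (x 0) (x 1) ≤ (∑ i, x i) / 100)
    (h₁₂ : imbalance (x 1) (x 2) ≤ (∑ i, x i) / 100) : Balanced x := by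
  have hsum := Fin.sum_univ_three x
  have d₀₁ := abs_le.mp (abs_sub_le_of_imbalance_le (hx 0) (hx 1) (by linarith [hx 2]) h₀₁)
  have d₁₂ := abs_le.mp (abs_sub_le_of_imbalance_le (hx 1) (hx 2) (by linarith [hx 0]) h₁₂)
  intro i
  fin_cases i <;> simp only [Fin.zero_eta, Fin.mk_one, Fin.reduceFinMk] <;> linarith

lemma balanced_of_loss_lt (hx : ∀ i, 0 ≤ x i) (hy : ∀ i, 0 ≤ y i) (hby : Balanced y)
    (h : loss x y < (∑ i, x i) * (∑ i, y i) / 500) : Balanced x := by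
  have imb_le : ∀ {i : Fin 3} {m : ℝ}, y i * m ≤ loss x y → m ≤ (∑ i, x i) / 100 := by
    intro i m hm
    have : (∑ i, x i) * (∑ i, y i) ≤ (∑ i, x i) * (5 * y i) :=
      mul_le_mul_of_nonneg_left (hby i) (Finset.sum_nonneg fun j _ => hx j)
    exact (lt_of_mul_lt_mul_left (by linarith : y i * m < y i * ((∑ i, x i) / 100)) (hy i)).le
  have hx₀ := mul_nonneg (hx 0) (imbalance_nonneg (hy 0) (hy 1))
  have hx₂ := mul_nonneg (hx 2) (imbalance_nonneg (hy 1) (hy 2))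
  have hy₀ := mul_nonneg (hy 0) (imbalance_nonneg (hx 1) (hx 2))
  have hy₂ := mul_nonneg (hy 2) (imbalance_nonneg (hx 0) (hx 1))
  refine balanced_of_imbalance_le hx (imb_le (i := 2) ?_) (imb_le (i := 0) ?_) <;>
    · unfold loss; linarith

lemma loss_le_potential (x y : Fin 3 → ℝ) : loss x y ≤ potential x y := by
  unfold potential
  split_ifs
  exacts [le_max_left _ _, le_rfl]

lemma le_potential_of_balanced (hx : ∀ i, 0 ≤ x i) (hy : ∀ i, 0 ≤ y i) (hby : Balanced y) :
    (∑ i, x i) * (∑ i, y i) / 500 ≤ potential x y := by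
  rcases lt_or_ge (loss x y) ((∑ i, x i) * (∑ i, y i) / 500) with h | h
  · rw [potential, if_pos ⟨balanced_of_loss_lt hx hy hby h, hby⟩]
    exact le_max_right _ _
  · exact h.trans (loss_le_potential x y)

lemma le_potential_const {a b : ℝ} (ha : 0 ≤ a) (hb : 0 ≤ b) :
    9 / 500 * (a * b) ≤ potential (fun _ => a) (fun _ => b) := by
  have sum_const (m : ℝ) : ∑ _i : Fin 3, m = 3 * m := by simp
  have balanced : Balanced fun _ => b := fun _ => by
    rw [sum_const]
    linarith
  convert le_potential_of_balanced (fun _ => ha) (fun _ => hb) balanced using 1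
  rw [sum_const, sum_const]
  ring

variable {κ : Type*} [Fintype κ]

lemma loss_sum_left {x : κ → Fin 3 → ℝ} (hx : ∀ k i, 0 ≤ x k i) (hy : ∀ i, 0 ≤ y i) :
    loss (fun i => ∑ k, x k i) y ≤ ∑ k, loss (x k) y := by
  simp only [loss, Finset.sum_add_distrib, ← Finset.mul_sum, ← Finset.sum_mul]
  gcongr
  · exact hy 2
  · exact imbalance_sum_le (fun k => hx k 0) (fun k => hx k 1)
  · exact hy 0
  · exact imbalance_sum_le (fun k => hx k 1) (fun k => hx k 2)

lemma potential_sum_left {x : κ → Fin 3 → ℝ} (hx : ∀ k i, 0 ≤ x k i) (hy : ∀ i, 0 ≤ y i) :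
    potential (fun i => ∑ k, x k i) y ≤ ∑ k, potential (x k) y := by
  have loss_le : loss (fun i => ∑ k, x k i) y ≤ ∑ k, potential (x k) y :=
    (loss_sum_left hx hy).trans (Finset.sum_le_sum fun k _ => loss_le_potential _ _)
  rw [potential]
  split_ifs with h
  · refine max_le loss_le ?_
    rw [Finset.sum_comm, Finset.sum_mul, Finset.sum_div]
    exact Finset.sum_le_sum fun k _ => le_potential_of_balanced (hx k) hy h.2
  · exact loss_le

lemma potential_sum_right {y : κ → Fin 3 → ℝ} (hx : ∀ i, 0 ≤ x i) (hy : ∀ k i, 0 ≤ y k i) :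
    potential x (fun i => ∑ k, y k i) ≤ ∑ k, potential x (y k) := by
  simp only [← potential_comp_rev x]
  exact potential_sum_left hy fun i => hx i.rev

end Potential

/-! ### Domino states -/

lemma sum_comp_le_sum {ι κ : Type*} [Fintype ι] {s : Finset κ} {E : κ → ℝ} {f : ι → κ}
    (hf : Function.Injective f) (hfs : ∀ i, f i ∈ s) (hE : ∀ k, 0 ≤ E k) :
    ∑ i, E (f i) ≤ ∑ k ∈ s, E k := by
  refine (Finset.sum_map Finset.univ ⟨f, hf⟩ E).symm.trans_le <|
    Finset.sum_le_sum_of_subset_of_nonneg (fun k hk => ?_) fun k _ _ => hE k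
  obtain ⟨i, -, rfl⟩ := Finset.mem_map.mp hk
  exact hfs i

section Domino

variable {S S' T Ω κ : Type*}

/-- `(u ± v) / √2`. -/
def mix (s : Bool) (u v : S → ℂ) : S → ℂ := ((Real.sqrt 2 : ℝ) : ℂ)⁻¹ • (u + sgn s • v)

/-- The eight product states of Bennett et al.'s domino basis of `ℂ³ ⊗ ℂ³` other than
`|1⟩ ⊗ |1⟩`, as four pairs `±`, with the basis vectors of the two sides replaced by `v` and `w`;
local maps act on the family through `v` and `w`. -/
def domino (v : Fin 3 → S → ℂ) (w : Fin 3 → S' → ℂ) : Fin 4 × Bool → S × S' → ℂ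
  | (0, s) => tensor (mix s (v 0) (v 1)) (w 2)
  | (1, s) => tensor (v 2) (mix s (w 1) (w 2))
  | (2, s) => tensor (mix s (v 1) (v 2)) (w 0)
  | (3, s) => tensor (v 0) (mix s (w 0) (w 1))

lemma map_mix (L : (S → ℂ) →ₗ[ℂ] (T → ℂ)) (s : Bool) (u v : S → ℂ) :
    L (mix s u v) = mix s (L u) (L v) := by simp [mix]

lemma onFst_domino (L : (S → ℂ) →ₗ[ℂ] (T → ℂ)) (v : Fin 3 → S → ℂ) (w : Fin 3 → S' → ℂ)
    (t : Fin 4 × Bool) : onFst L (domino v w t) = domino (fun i => L (v i)) w t := by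
  obtain ⟨j, s⟩ := t
  fin_cases j <;> simp [domino, onFst_tensor, map_mix]

lemma onSnd_domino (L : (S' → ℂ) →ₗ[ℂ] (T → ℂ)) (v : Fin 3 → S → ℂ) (w : Fin 3 → S' → ℂ)
    (t : Fin 4 × Bool) : onSnd L (domino v w t) = domino v (fun i => L (w i)) t := by
  obtain ⟨j, s⟩ := t
  fin_cases j <;> simp [domino, onSnd_tensor, map_mix]

lemma normSq_inv_sqrt_two : Complex.normSq (((Real.sqrt 2 : ℝ) : ℂ)⁻¹) = 1 / 2 := by
  rw [Complex.normSq_inv, Complex.normSq_ofReal, Real.mul_self_sqrt zero_le_two, one_div]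

variable [Fintype S] [Fintype S'] [Fintype T] [Fintype κ]

lemma sqNorm_mix (s : Bool) (u v : S → ℂ) :
    sqNorm (mix s u v) = ∑ x, Complex.normSq (u x + sgn s * v x) / 2 := by
  simp only [sqNorm, mix, Pi.smul_apply, Pi.add_apply, smul_eq_mul, Complex.normSq_mul,
    normSq_inv_sqrt_two, one_div_mul_eq_div]

lemma sum_sqNorm_mix (u v : S → ℂ) : ∑ s, sqNorm (mix s u v) = sqNorm u + sqNorm v := by
  rw [Fintype.sum_bool, sqNorm_mix, sqNorm_mix, sqNorm, sqNorm, ← Finset.sum_add_distrib,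
    ← Finset.sum_add_distrib]
  refine Finset.sum_congr rfl fun x _ => ?_
  simp only [sgn, Complex.normSq_apply, if_true, Bool.false_eq_true, if_false, neg_mul, one_mul,
    Complex.add_re, Complex.add_im, Complex.neg_re, Complex.neg_im]
  ring

lemma imbalance_normSq_le (s : Bool) (a b : ℂ) :
    imbalance (Complex.normSq a) (Complex.normSq b) ≤ 2 * Complex.normSq (a + sgn s * b) := by
  have abs_sub_le : |‖a‖ - ‖b‖| ≤ ‖a + sgn s * b‖ := by
    cases s
    · simpa [sgn, sub_eq_add_neg] using abs_norm_sub_norm_le a b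
    · simpa [sgn] using abs_norm_sub_norm_le a (-b)
  have sq_sub_le : (‖a‖ - ‖b‖) ^ 2 ≤ ‖a + sgn s * b‖ ^ 2 := by
    rw [← sq_abs]
    gcongr
  simp only [imbalance, Complex.normSq_eq_norm_sq]
  refine div_le_of_le_mul₀ (by positivity) (by positivity) ?_
  calc (‖a‖ ^ 2 - ‖b‖ ^ 2) ^ 2 = (‖a‖ - ‖b‖) ^ 2 * (‖a‖ + ‖b‖) ^ 2 := by ring
    _ ≤ ‖a + sgn s * b‖ ^ 2 * (2 * (‖a‖ ^ 2 + ‖b‖ ^ 2)) := by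
      gcongr
      exact add_sq_le
    _ = 2 * ‖a + sgn s * b‖ ^ 2 * (‖a‖ ^ 2 + ‖b‖ ^ 2) := by ring

lemma imbalance_sqNorm_le (s : Bool) (u v : S → ℂ) :
    imbalance (sqNorm u) (sqNorm v) ≤ 4 * sqNorm (mix s u v) :=
  calc imbalance (sqNorm u) (sqNorm v)
      ≤ ∑ x, imbalance (Complex.normSq (u x)) (Complex.normSq (v x)) :=
        imbalance_sum_le (fun _ => Complex.normSq_nonneg _) fun _ => Complex.normSq_nonneg _
    _ ≤ ∑ x, 2 * Complex.normSq (u x + sgn s * v x) :=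
        Finset.sum_le_sum fun x _ => imbalance_normSq_le s _ _
    _ = 4 * sqNorm (mix s u v) := by
        rw [sqNorm_mix, Finset.mul_sum]
        exact Finset.sum_congr rfl fun _ _ => by ring

lemma loss_le_four_mul_sum (v : Fin 3 → S → ℂ) (w : Fin 3 → S' → ℂ) (s : Bool) :
    loss (fun i => sqNorm (v i)) (fun i => sqNorm (w i)) ≤
      4 * ∑ j, sqNorm (domino v w (j, s)) := by
  have pair₀ := mul_le_mul_of_nonneg_left (imbalance_sqNorm_le s (v 0) (v 1)) (sqNorm_nonneg (w 2))
  have pair₁ := mul_le_mul_of_nonneg_left (imbalance_sqNorm_le s (w 1) (w 2)) (sqNorm_nonneg (v 2))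
  have pair₂ := mul_le_mul_of_nonneg_left (imbalance_sqNorm_le s (v 1) (v 2)) (sqNorm_nonneg (w 0))
  have pair₃ := mul_le_mul_of_nonneg_left (imbalance_sqNorm_le s (w 0) (w 1)) (sqNorm_nonneg (v 0))
  simp only [loss, Fin.sum_univ_four, domino, sqNorm_tensor]
  linarith

lemma mul_sum_le_sum_sqNorm_pair {v : Fin 3 → S → ℂ} {w : Fin 3 → S' → ℂ}
    (hv : Balanced fun i => sqNorm (v i)) (hw : Balanced fun i => sqNorm (w i)) (j : Fin 4) :
    2 / 25 * ((∑ i, sqNorm (v i)) * ∑ i, sqNorm (w i)) ≤ ∑ s, sqNorm (domino v w (j, s)) := by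
  have mul_le : ∀ i k, 1 / 25 * ((∑ i, sqNorm (v i)) * ∑ i, sqNorm (w i)) ≤
      sqNorm (v i) * sqNorm (w k) := fun i k => by
    have := mul_le_mul (hv i) (hw k) (Finset.sum_nonneg fun _ _ => sqNorm_nonneg _)
      (by linarith [sqNorm_nonneg (v i)])
    linarith
  fin_cases j <;>
    simp only [domino, sqNorm_tensor, ← Finset.sum_mul, ← Finset.mul_sum, sum_sqNorm_mix]
  · linarith [mul_le 0 2, mul_le 1 2]
  · linarith [mul_le 2 1, mul_le 2 2]
  · linarith [mul_le 1 0, mul_le 2 0]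
  · linarith [mul_le 0 0, mul_le 0 1]

lemma potential_le_four_mul_sum_erase (v : Fin 3 → S → ℂ) (w : Fin 3 → S' → ℂ)
    (t₀ : Fin 4 × Bool) : potential (fun i => sqNorm (v i)) (fun i => sqNorm (w i)) ≤
      4 * ∑ t ∈ Finset.univ.erase t₀, sqNorm (domino v w t) := by
  have loss_le : loss (fun i => sqNorm (v i)) (fun i => sqNorm (w i)) ≤
      4 * ∑ t ∈ Finset.univ.erase t₀, sqNorm (domino v w t) := by
    refine (loss_le_four_mul_sum v w (!t₀.2)).trans ?_
    gcongr
    exact sum_comp_le_sum (f := fun j => (j, !t₀.2)) (fun _ _ h => congrArg Prod.fst h)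
      (fun j => by simp [Prod.ext_iff]) fun _ => sqNorm_nonneg _
  rw [potential]
  split_ifs with h
  · refine max_le loss_le ?_
    obtain ⟨j, hj⟩ := exists_ne t₀.1
    have pair_le : ∑ s, sqNorm (domino v w (j, s)) ≤
        ∑ t ∈ Finset.univ.erase t₀, sqNorm (domino v w t) :=
      sum_comp_le_sum (fun _ _ h => congrArg Prod.snd h)
        (fun s => by simp [Prod.ext_iff, hj]) fun _ => sqNorm_nonneg _
    have := mul_sum_le_sum_sqNorm_pair h.1 h.2 j
    have := mul_nonneg (Finset.sum_nonneg fun i (_ : i ∈ Finset.univ) => sqNorm_nonneg (v i))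
      (Finset.sum_nonneg fun i (_ : i ∈ Finset.univ) => sqNorm_nonneg (w i))
    linarith
  · exact loss_le

/-! ### Failure across a bipartite cut -/

/-- If `F t ψ` is the weight with which a protocol started in the subnormalized state `ψ` announces
`t`, then on the domino states, weighted by `q`, it fails with weight at least `c` times the
potential of the squared norms of `v` and `w`, whatever `v` and `w` are. -/
def FailsAtLeast (c : ℝ) (q : Fin 4 × Bool → ℝ) (F : Fin 4 × Bool → (S × S' → ℂ) → ℝ) : Prop :=
  ∀ (v : Fin 3 → S → ℂ) (w : Fin 3 → S' → ℂ),
    c * potential (fun i => sqNorm (v i)) (fun i => sqNorm (w i)) ≤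
      ∑ t, q t * (sqNorm (domino v w t) - F t (domino v w t))

variable {c : ℝ} {q : Fin 4 × Bool → ℝ}

lemma FailsAtLeast.left {F : κ → Fin 4 × Bool → (T × S' → ℂ) → ℝ} (hc : 0 ≤ c)
    {L : κ → (S → ℂ) →ₗ[ℂ] (T → ℂ)} (hL : PreservesSqNorm L) (hF : ∀ k, FailsAtLeast c q (F k)) :
    FailsAtLeast c q fun t (ψ : S × S' → ℂ) => ∑ k, F k t (onFst (L k) ψ) := fun v w =>
  calc c * potential (fun i => sqNorm (v i)) (fun i => sqNorm (w i))
      = c * potential (fun i => ∑ k, sqNorm (L k (v i))) (fun i => sqNorm (w i)) := by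
        simp only [hL _]
    _ ≤ ∑ k, c * potential (fun i => sqNorm (L k (v i))) (fun i => sqNorm (w i)) := by
        rw [← Finset.mul_sum]
        gcongr
        exact potential_sum_left (fun _ _ => sqNorm_nonneg _) fun _ => sqNorm_nonneg _
    _ ≤ ∑ k, ∑ t, q t * (sqNorm (onFst (L k) (domino v w t)) -
          F k t (onFst (L k) (domino v w t))) := by
        simp only [onFst_domino]
        exact Finset.sum_le_sum fun k _ => hF k _ w
    _ = ∑ t, q t * (sqNorm (domino v w t) - ∑ k, F k t (onFst (L k) (domino v w t))) := by
        rw [Finset.sum_comm]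
        simp only [← Finset.mul_sum, Finset.sum_sub_distrib, hL.onFst _]

lemma FailsAtLeast.right {F : κ → Fin 4 × Bool → (S × T → ℂ) → ℝ} (hc : 0 ≤ c)
    {L : κ → (S' → ℂ) →ₗ[ℂ] (T → ℂ)} (hL : PreservesSqNorm L) (hF : ∀ k, FailsAtLeast c q (F k)) :
    FailsAtLeast c q fun t (ψ : S × S' → ℂ) => ∑ k, F k t (onSnd (L k) ψ) := fun v w =>
  calc c * potential (fun i => sqNorm (v i)) (fun i => sqNorm (w i))
      = c * potential (fun i => sqNorm (v i)) (fun i => ∑ k, sqNorm (L k (w i))) := by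
        simp only [hL _]
    _ ≤ ∑ k, c * potential (fun i => sqNorm (v i)) (fun i => sqNorm (L k (w i))) := by
        rw [← Finset.mul_sum]
        gcongr
        exact potential_sum_right (fun _ => sqNorm_nonneg _) fun _ _ => sqNorm_nonneg _
    _ ≤ ∑ k, ∑ t, q t * (sqNorm (onSnd (L k) (domino v w t)) -
          F k t (onSnd (L k) (domino v w t))) := by
        simp only [onSnd_domino]
        exact Finset.sum_le_sum fun k _ => hF k v _
    _ = ∑ t, q t * (sqNorm (domino v w t) - ∑ k, F k t (onSnd (L k) (domino v w t))) := by
        rw [Finset.sum_comm]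
        simp only [← Finset.mul_sum, Finset.sum_sub_distrib, hL.onSnd _]

open Classical in
lemma failsAtLeast_announce {lab : Fin 4 × Bool → Ω} (hlab : Function.Injective lab) (hc : 0 ≤ c)
    (hq : ∀ t, 4 * c ≤ q t) (ω : Ω) :
    FailsAtLeast c q fun t (ψ : S × S' → ℂ) => if ω = lab t then sqNorm ψ else 0 := by
  intro v w
  obtain ⟨t₀, ht₀⟩ : ∃ t₀, ∀ t, t ≠ t₀ → ω ≠ lab t := by
    by_cases h : ∃ t, ω = lab t
    · obtain ⟨t₀, rfl⟩ := h
      exact ⟨t₀, fun t ht h => ht (hlab h.symm)⟩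
    · exact ⟨default, fun t _ ht => h ⟨t, ht⟩⟩
  calc c * potential (fun i => sqNorm (v i)) (fun i => sqNorm (w i))
      ≤ c * (4 * ∑ t ∈ Finset.univ.erase t₀, sqNorm (domino v w t)) :=
        mul_le_mul_of_nonneg_left (potential_le_four_mul_sum_erase v w t₀) hc
    _ = ∑ t ∈ Finset.univ.erase t₀, 4 * c * sqNorm (domino v w t) := by
        rw [← Finset.mul_sum]
        ring
    _ ≤ ∑ t ∈ Finset.univ.erase t₀, q t * (sqNorm (domino v w t) -
          if ω = lab t then sqNorm (domino v w t) else 0) := by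
        refine Finset.sum_le_sum fun t ht => ?_
        rw [if_neg (ht₀ t (Finset.ne_of_mem_erase ht)), sub_zero]
        exact mul_le_mul_of_nonneg_right (hq t) (sqNorm_nonneg _)
    _ ≤ ∑ t, q t * (sqNorm (domino v w t) -
          if ω = lab t then sqNorm (domino v w t) else 0) := by
        refine Finset.sum_le_sum_of_subset_of_nonneg (Finset.erase_subset _ _) fun t _ _ => ?_
        refine mul_nonneg (by linarith [hq t]) ?_
        split_ifs <;> simp [sqNorm_nonneg]

end Domino

/-- Regrouping the three systems across the cut between Bob and the other two parties. -/
def cutAC (A B C : Type*) : A × B × C ≃ (A × C) × B :=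
  ((Equiv.refl A).prodCongr (Equiv.prodComm B C)).trans (Equiv.prodAssoc A C B).symm

section Cuts

variable {Ω A B C : Type} {c : ℝ} {q : Fin 4 × Bool → ℝ} {lab : Fin 4 × Bool → Ω}

lemma failsAtLeast_pureProb_cutAB (hlab : Function.Injective lab) (hc : 0 ≤ c)
    (hq : ∀ t, 4 * c ≤ q t) (P : LOCC Ω A B C) : ∀ [Fintype A] [Fintype B] [Fintype C],
    FailsAtLeast c q fun t ψ => P.pureProb (lab t) (ψ ∘ (Equiv.prodAssoc A B C).symm) := by
  induction P with
  | announce ω =>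
    intro _ _ _
    simp only [LOCC.pureProb, sqNorm_comp_equiv]
    exact failsAtLeast_announce hlab hc hq ω
  | alice κ A' K hK next ih =>
    intro _ _ _
    exact (FailsAtLeast.left hc hK.preservesSqNorm.onFst fun k => ih k :)
  | bob κ B' K hK next ih =>
    intro _ _ _
    exact (FailsAtLeast.left hc hK.preservesSqNorm.onSnd fun k => ih k :)
  | charlie κ C' K hK next ih =>
    intro _ _ _
    exact (FailsAtLeast.right hc hK.preservesSqNorm fun k => ih k :)

lemma failsAtLeast_pureProb_cutBC (hlab : Function.Injective lab) (hc : 0 ≤ c)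
    (hq : ∀ t, 4 * c ≤ q t) (P : LOCC Ω A B C) : ∀ [Fintype A] [Fintype B] [Fintype C],
    FailsAtLeast c q fun t (ψ : A × B × C → ℂ) => P.pureProb (lab t) ψ := by
  induction P with
  | announce ω =>
    intro _ _ _
    exact failsAtLeast_announce hlab hc hq ω
  | alice κ A' K hK next ih =>
    intro _ _ _
    exact (FailsAtLeast.left hc hK.preservesSqNorm fun k => ih k :)
  | bob κ B' K hK next ih =>
    intro _ _ _
    exact (FailsAtLeast.right hc hK.preservesSqNorm.onFst fun k => ih k :)
  | charlie κ C' K hK next ih =>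
    intro _ _ _
    exact (FailsAtLeast.right hc hK.preservesSqNorm.onSnd fun k => ih k :)

lemma failsAtLeast_pureProb_cutAC (hlab : Function.Injective lab) (hc : 0 ≤ c)
    (hq : ∀ t, 4 * c ≤ q t) (P : LOCC Ω A B C) : ∀ [Fintype A] [Fintype B] [Fintype C],
    FailsAtLeast c q fun t ψ => P.pureProb (lab t) (ψ ∘ cutAC A B C) := by
  induction P with
  | announce ω =>
    intro _ _ _
    simp only [LOCC.pureProb, sqNorm_comp_equiv]
    exact failsAtLeast_announce hlab hc hq ω
  | alice κ A' K hK next ih =>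
    intro _ _ _
    exact (FailsAtLeast.left hc hK.preservesSqNorm.onFst fun k => ih k :)
  | bob κ B' K hK next ih =>
    intro _ _ _
    exact (FailsAtLeast.right hc hK.preservesSqNorm fun k => ih k :)
  | charlie κ C' K hK next ih =>
    intro _ _ _
    exact (FailsAtLeast.left hc hK.preservesSqNorm.onSnd fun k => ih k :)

end Cuts

/-! ### The fourteen states -/

section States

/-- The two basis vectors of `ℂ⁴ ⊗ ℂ³ ⊗ ℂ³` whose combinations with coefficients `1 / √2` and
`± 1 / √2` are the states of a pair. -/
def tile : Fin 7 → (Fin 4 × Fin 3 × Fin 3) × (Fin 4 × Fin 3 × Fin 3) :=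
  ![((0, 2, 2), (1, 2, 2)), ((2, 1, 2), (2, 2, 2)), ((1, 0, 2), (2, 0, 2)), ((0, 0, 2), (0, 1, 2)),
    ((3, 2, 1), (3, 2, 2)), ((1, 2, 0), (3, 2, 0)), ((0, 2, 0), (0, 2, 1))]

variable {A B : Type} [DecidableEq A] [DecidableEq B]

lemma ket_prod (i : A × B) (x : A × B) : ket i x = ket i.1 x.1 * ket i.2 x.2 := by
  simp only [ket, Pi.single_apply, Prod.ext_iff, ite_and, ite_mul, one_mul, zero_mul]

lemma zeta_eq_pm (j : Fin 7) (s : Bool) : zeta (j, s) = pm (tile j).1 (tile j).2 s := by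
  ext x
  fin_cases j <;> simp [zeta, prod3, pm, tile, ket_prod] <;> ring

variable [Fintype A]

lemma sqNorm_ket (i : A) : sqNorm (ket i) = 1 := by
  simp [sqNorm, ket, Pi.single_apply, apply_ite Complex.normSq]

lemma sqNorm_pm {i j : A} (hij : i ≠ j) (s : Bool) : sqNorm (pm i j s) = 1 := by
  refine (sqNorm_mix s (ket i) (ket j)).trans ?_
  rw [Fintype.sum_eq_add i j hij fun x hx => by simp [ket, hx]]
  cases s <;> simp [ket, hij, hij.symm, sgn] <;> norm_num

lemma sqNorm_zeta (i : Label) : sqNorm (zeta i) = 1 := by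
  obtain ⟨j, s⟩ := i
  rw [zeta_eq_pm, sqNorm_pm (by revert j; decide)]

end States

/-! ### Pure resources -/

section Resources

variable {A B C RA RB RC D E : Type}

/-- The vector `ζ ⊗ r`, each party holding its part of both. -/
def attach (ζ : A × B × C → ℂ) (r : RA × RB × RC → ℂ) : (A × RA) × (B × RB) × (C × RC) → ℂ :=
  tensor ζ r ∘ (((Equiv.refl _).prodCongr (Equiv.prodProdProdComm B RB C RC)).trans
    (Equiv.prodProdProdComm A RA (B × C) (RB × RC)))

lemma attach_apply (ζ : A × B × C → ℂ) (r : RA × RB × RC → ℂ) (a : A × RA) (b : B × RB)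
    (c : C × RC) : attach ζ r (a, b, c) = ζ (a.1, b.1, c.1) * r (a.2, b.2, c.2) := rfl

lemma withResource_sum_proj {ι : Type*} [Fintype ι] (ζ : A × B × C → ℂ)
    (r : ι → RA × RB × RC → ℂ) :
    withResource (proj ζ) (∑ l, proj (r l)) = ∑ l, proj (attach ζ (r l)) := by
  ext x y
  simp only [withResource, Matrix.sum_apply, Finset.mul_sum]
  refine Finset.sum_congr rfl fun l _ => ?_
  simp only [proj, Matrix.vecMulVec_apply, Pi.star_apply, attach, Function.comp_apply, tensor,
    star_mul']
  exact mul_mul_mul_comm _ _ _ _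

variable [Fintype A] [Fintype B] [Fintype C] [Fintype RA] [Fintype RB] [Fintype RC]

lemma sqNorm_attach (ζ : A × B × C → ℂ) (r : RA × RB × RC → ℂ) :
    sqNorm (attach ζ r) = sqNorm ζ * sqNorm r := by
  rw [attach, sqNorm_comp_equiv, sqNorm_tensor]

/-- The probability, weighted by `p`, that the protocol `P` assisted by the subnormalized pure
resource `r` does not identify the state. -/
def failure (p : Label → ℝ) (P : LOCC Label (Fin 4 × RA) (Fin 3 × RB) (Fin 3 × RC))
    (r : RA × RB × RC → ℂ) : ℝ :=
  ∑ i, p i * (sqNorm (attach (zeta i) r) - P.pureProb i (attach (zeta i) r))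

lemma failure_nonneg {p : Label → ℝ} (hp : ∀ i, 0 ≤ p i)
    (P : LOCC Label (Fin 4 × RA) (Fin 3 × RB) (Fin 3 × RC)) (r : RA × RB × RC → ℂ) :
    0 ≤ failure p P r :=
  Finset.sum_nonneg fun i _ => mul_nonneg (hp i) (sub_nonneg.mpr (P.pureProb_mem_Icc i _).2)

lemma success_sum_proj {ι : Type} [Fintype ι] (p : Label → ℝ) (r : ι → RA × RB × RC → ℂ)
    (P : LOCC Label (Fin 4 × RA) (Fin 3 × RB) (Fin 3 × RC)) :
    success p (∑ l, proj (r l)) P = (∑ i, p i) * ∑ l, sqNorm (r l) - ∑ l, failure p P (r l) := by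
  simp only [success, failure, withResource_sum_proj, LOCC.prob_sum_proj, sqNorm_attach,
    sqNorm_zeta, one_mul, mul_sub, Finset.sum_sub_distrib, ← Finset.sum_mul, Finset.mul_sum]
  rw [Finset.sum_comm (s := Finset.univ (α := ι)), sub_sub_cancel]

open scoped MatrixOrder Matrix.Norms.L2Operator in
lemma IsDensity.exists_sum_proj {ρ : Matrix A A ℂ} (hρ : IsDensity ρ) :
    ∃ r : A → A → ℂ, ρ = ∑ l, proj (r l) ∧ ∑ l, sqNorm (r l) = 1 := by
  classical
  obtain ⟨M, hM⟩ := CStarAlgebra.nonneg_iff_eq_star_mul_self.mp hρ.1.nonneg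
  have h : ρ = ∑ l, proj (star (M l)) := by
    ext x y
    rw [hM, Matrix.star_eq_conjTranspose]
    simp [Matrix.mul_apply, Matrix.sum_apply, proj, Matrix.vecMulVec_apply]
  refine ⟨fun l => star (M l), h, ?_⟩
  have htrace := congrArg Complex.re hρ.2
  rw [h, Matrix.trace_sum, Complex.re_sum] at htrace
  simpa only [trace_proj, Complex.one_re] using htrace

lemma payoff_lt_of_le_failure {p : Label → ℝ} {c : ℝ} (hc : 0 < c)
    {ρ : Matrix (RA × RB × RC) (RA × RB × RC) ℂ} (hρ : IsDensity ρ)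
    (h : ∀ (P : LOCC Label (Fin 4 × RA) (Fin 3 × RB) (Fin 3 × RC)) (r : RA × RB × RC → ℂ),
      c * sqNorm r ≤ failure p P r) : payoff p ρ < ∑ i, p i := by
  obtain ⟨r, rfl, hr⟩ := hρ.exists_sum_proj
  have : Nonempty (LOCC Label (Fin 4 × RA) (Fin 3 × RB) (Fin 3 × RC)) := ⟨.announce default⟩
  refine (ciSup_le fun P => ?_).trans_lt (sub_lt_self _ hc)
  have failure_ge := Finset.sum_le_sum fun l (_ : l ∈ Finset.univ) => h P (r l)
  rw [← Finset.mul_sum, hr] at failure_ge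
  rw [success_sum_proj, hr]
  linarith

lemma IsDensity.submatrix {ρ : Matrix A A ℂ} (hρ : IsDensity ρ) (e : B ≃ A) :
    IsDensity (ρ.submatrix e e) :=
  ⟨hρ.1.submatrix e, (e.sum_comp fun x => ρ x x).trans hρ.2⟩

/-! ### Bipartite resources fail -/

lemma mul_sqNorm_le_failure {S S' : Type*} [Fintype S] [Fintype S'] {p : Label → ℝ} {c : ℝ}
    (hc : 0 ≤ c) (hp : ∀ i, 4 * c ≤ p i) {lab : Fin 4 × Bool → Label}
    (hlab : Function.Injective lab)
    {P : LOCC Label (Fin 4 × RA) (Fin 3 × RB) (Fin 3 × RC)} {r : RA × RB × RC → ℂ}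
    {e : (Fin 4 × RA) × (Fin 3 × RB) × (Fin 3 × RC) ≃ S × S'}
    (hP : FailsAtLeast c (p ∘ lab) fun t ψ => P.pureProb (lab t) (ψ ∘ e))
    {v : Fin 3 → S → ℂ} {w : Fin 3 → S' → ℂ} {a b : ℝ} (hv : ∀ i, sqNorm (v i) = a)
    (hw : ∀ i, sqNorm (w i) = b) (hab : a * b = sqNorm r)
    (hr : ∀ t, attach (zeta (lab t)) r = domino v w t ∘ e) :
    c * (9 / 500) * sqNorm r ≤ failure p P r :=
  calc c * (9 / 500) * sqNorm r = c * (9 / 500 * (a * b)) := by rw [hab, mul_assoc]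
    _ ≤ c * potential (fun i => sqNorm (v i)) (fun i => sqNorm (w i)) := by
        simp only [hv, hw]
        gcongr
        exact le_potential_const (hv 0 ▸ sqNorm_nonneg _) (hw 0 ▸ sqNorm_nonneg _)
    _ ≤ ∑ t, p (lab t) * (sqNorm (attach (zeta (lab t)) r) -
          P.pureProb (lab t) (attach (zeta (lab t)) r)) := by
        simp only [hr, sqNorm_comp_equiv]
        exact hP v w
    _ ≤ failure p P r :=
        sum_comp_le_sum (E := fun i => p i * (sqNorm (attach (zeta i) r) -
          P.pureProb i (attach (zeta i) r))) hlab (fun _ => Finset.mem_univ _) fun i =>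
            mul_nonneg (by linarith [hp i]) (sub_nonneg.mpr (P.pureProb_mem_Icc i _).2)

lemma exists_pos_forall_four_mul_le {ι : Type*} [Finite ι] [Nonempty ι] {p : ι → ℝ}
    (hp : ∀ i, 0 < p i) : ∃ c > 0, ∀ i, 4 * c ≤ p i := by
  obtain ⟨i₀, h⟩ := Finite.exists_min p
  exact ⟨p i₀ / 4, by linarith [hp i₀], fun i => by linarith [h i]⟩

/-- The vector `|i⟩ ⊗ |j⟩ ⊗ r`, each of two parties holding its part of both. -/
def ketWith [DecidableEq A] [DecidableEq B] (i : A) (j : B) (r : D × E → ℂ) :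
    (A × D) × (B × E) → ℂ :=
  tensor (tensor (ket i) (ket j)) r ∘ Equiv.prodProdProdComm A D B E

variable [Fintype D] [Fintype E]

lemma sqNorm_ketWith [DecidableEq A] [DecidableEq B] (i : A) (j : B) (r : D × E → ℂ) :
    sqNorm (ketWith i j r) = sqNorm r := by
  rw [ketWith, sqNorm_comp_equiv, sqNorm_tensor, sqNorm_tensor, sqNorm_ket, sqNorm_ket, one_mul,
    one_mul]

lemma payoff_sharedAB_lt {p : Label → ℝ} (hp : ∀ i, 0 < p i) {ρ : Matrix (D × E) (D × E) ℂ}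
    (hρ : IsDensity ρ) : payoff p (sharedAB ρ) < ∑ i, p i := by
  obtain ⟨c, hc, hcp⟩ := exists_pos_forall_four_mul_le hp
  let e : D × E × Unit ≃ D × E := (Equiv.refl D).prodCongr (Equiv.prodPUnit E)
  have lab_injective : Function.Injective (Prod.map ![0, 4, 5, 6] id : Fin 4 × Bool → Label) := by
    decide
  refine payoff_lt_of_le_failure (c := c * (9 / 500)) (by positivity) (hρ.submatrix e)
    fun P r => mul_sqNorm_le_failure hc.le hcp lab_injective
      (failsAtLeast_pureProb_cutAB lab_injective hc.le (fun t => hcp _) P)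
      (v := fun i => ketWith (![0, 1, 3] i) 2 (r ∘ e.symm))
      (w := fun i => ket i ∘ Equiv.prodPUnit (Fin 3)) (a := sqNorm r) (b := 1)
      (fun i => ?_) (fun i => ?_) (mul_one _) ?_
  · rw [sqNorm_ketWith, sqNorm_comp_equiv]
  · rw [sqNorm_comp_equiv, sqNorm_ket]
  · rintro ⟨j, s⟩
    ext ⟨⟨a, x⟩, ⟨b, y⟩, ⟨c, -⟩⟩
    fin_cases j <;> simp [attach, zeta, domino, ketWith, tensor, mix, pm, prod3, e] <;> ring

lemma payoff_sharedBC_lt {p : Label → ℝ} (hp : ∀ i, 0 < p i) {ρ : Matrix (D × E) (D × E) ℂ}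
    (hρ : IsDensity ρ) : payoff p (sharedBC ρ) < ∑ i, p i := by
  obtain ⟨c, hc, hcp⟩ := exists_pos_forall_four_mul_le hp
  let e : Unit × D × E ≃ D × E := Equiv.punitProd (D × E)
  have lab_injective : Function.Injective (Prod.map ![0, 1, 2, 3] id : Fin 4 × Bool → Label) := by
    decide
  refine payoff_lt_of_le_failure (c := c * (9 / 500)) (by positivity) (hρ.submatrix e)
    fun P r => mul_sqNorm_le_failure hc.le hcp lab_injective
      (failsAtLeast_pureProb_cutBC lab_injective hc.le (fun t => hcp _) P) (e := Equiv.refl _)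
      (v := fun i => ket (![0, 1, 2] i) ∘ Equiv.prodPUnit (Fin 4))
      (w := fun i => ketWith i 2 (r ∘ e.symm)) (a := 1) (b := sqNorm r)
      (fun i => ?_) (fun i => ?_) (one_mul _) ?_
  · rw [sqNorm_comp_equiv, sqNorm_ket]
  · rw [sqNorm_ketWith, sqNorm_comp_equiv]
  · rintro ⟨j, s⟩
    ext ⟨⟨a, -⟩, ⟨b, x⟩, ⟨c, y⟩⟩
    fin_cases j <;> simp [attach, zeta, domino, ketWith, tensor, mix, pm, prod3, e] <;> ring

lemma payoff_sharedAC_lt {p : Label → ℝ} (hp : ∀ i, 0 < p i) {ρ : Matrix (D × E) (D × E) ℂ}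
    (hρ : IsDensity ρ) : payoff p (sharedAC ρ) < ∑ i, p i := by
  obtain ⟨c, hc, hcp⟩ := exists_pos_forall_four_mul_le hp
  let e : D × Unit × E ≃ D × E := (Equiv.refl D).prodCongr (Equiv.punitProd E)
  have lab_injective : Function.Injective (Prod.map ![0, 1, 2, 3] id : Fin 4 × Bool → Label) := by
    decide
  refine payoff_lt_of_le_failure (c := c * (9 / 500)) (by positivity) (hρ.submatrix e)
    fun P r => mul_sqNorm_le_failure hc.le hcp lab_injective
      (failsAtLeast_pureProb_cutAC lab_injective hc.le (fun t => hcp _) P)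
      (v := fun i => ketWith (![0, 1, 2] i) 2 (r ∘ e.symm))
      (w := fun i => ket i ∘ Equiv.prodPUnit (Fin 3)) (a := sqNorm r) (b := 1)
      (fun i => ?_) (fun i => ?_) (mul_one _) ?_
  · rw [sqNorm_ketWith, sqNorm_comp_equiv]
  · rw [sqNorm_comp_equiv, sqNorm_ket]
  · rintro ⟨j, s⟩
    ext ⟨⟨a, x⟩, ⟨b, -⟩, ⟨c, y⟩⟩
    fin_cases j <;> simp [attach, zeta, domino, ketWith, tensor, mix, pm, prod3, cutAC, e] <;> ring

end Resources

/-! ### The GHZ state suffices -/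

section Measurements

variable {Ω A B C A' B' C' κ : Type}

/-- The measurement of the value of `g` in the computational basis. -/
def valueMeas [DecidableEq A] [DecidableEq κ] (g : A → κ) (k : κ) : Matrix A A ℂ :=
  Matrix.diagonal fun x => if g x = k then 1 else 0

/-- The measurement of the eigenvalue `±1` of an involution of the computational basis. -/
def signMeas [DecidableEq A] (σ : Equiv.Perm A) (t : Bool) : Matrix A A ℂ :=
  (1 / 2 : ℂ) • (1 + sgn t • σ.permMatrix ℂ)

lemma isMeasurement_valueMeas [Fintype A] [DecidableEq A] [Fintype κ] [DecidableEq κ] (g : A → κ) :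
    IsMeasurement (valueMeas g) := by
  ext x y
  simp only [valueMeas, Matrix.diagonal_conjTranspose, Matrix.diagonal_mul_diagonal,
    Matrix.sum_apply, Matrix.diagonal_apply, Matrix.one_apply]
  by_cases h : x = y <;> simp [h]

lemma isMeasurement_signMeas [Fintype A] [DecidableEq A] {σ : Equiv.Perm A}
    (hσ : Function.Involutive σ) : IsMeasurement (signMeas σ) := by
  have mul_self : σ.permMatrix ℂ * σ.permMatrix ℂ = 1 := by
    rw [← Matrix.permMatrix_mul, show σ * σ = 1 from Equiv.ext hσ, Matrix.permMatrix_one]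
  have isSelfAdjoint : (σ.permMatrix ℂ)ᴴ = σ.permMatrix ℂ := by
    rw [Matrix.conjTranspose_permMatrix, inv_eq_of_mul_eq_one_right (Equiv.ext hσ)]
  have sum_eq_one : ∑ t, (signMeas σ t)ᴴ * signMeas σ t = 1 := by
    simp only [Fintype.sum_bool, signMeas, sgn, Matrix.conjTranspose_smul, Matrix.conjTranspose_add,
      Matrix.conjTranspose_one, isSelfAdjoint, Matrix.smul_mul, Matrix.mul_smul, add_mul, mul_add,
      mul_self, one_mul, mul_one]
    simp only [one_div, star_inv₀, star_ofNat, if_true, star_one, one_smul, smul_add,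
      Bool.false_eq_true, if_false, star_neg, neg_smul, smul_neg, neg_neg]
    module
  rw [IsMeasurement, sum_eq_one]
  congr!

lemma valueMeas_mulVec [Fintype A] [DecidableEq A] [DecidableEq κ] (g : A → κ) (k : κ)
    (ψ : A → ℂ) (x : A) : (valueMeas g k *ᵥ ψ) x = if g x = k then ψ x else 0 := by
  simp [valueMeas, Matrix.mulVec_diagonal]

lemma signMeas_mulVec [Fintype A] [DecidableEq A] (σ : Equiv.Perm A) (t : Bool) (ψ : A → ℂ)
    (x : A) : (signMeas σ t *ᵥ ψ) x = (ψ x + sgn t * ψ (σ x)) / 2 := by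
  simp only [signMeas, Matrix.smul_mulVec, Matrix.add_mulVec, Matrix.one_mulVec,
    Matrix.permMatrix_mulVec, Pi.smul_apply, Pi.add_apply, smul_eq_mul, Function.comp_apply]
  ring

variable [Fintype A] [Fintype B] [Fintype C]

/-- Run on `ψ`, the protocol announces `i` for sure. -/
def LOCC.Identifies (P : LOCC Ω A B C) (i : Ω) (ψ : A × B × C → ℂ) : Prop :=
  P.pureProb i ψ = sqNorm ψ

variable {i : Ω} {ψ : A × B × C → ℂ}

lemma identifies_zero (P : LOCC Ω A B C) (i : Ω) : P.Identifies i 0 :=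
  have h := P.pureProb_mem_Icc i 0
  le_antisymm h.2 (sqNorm_zero.trans_le h.1)

lemma identifies_announce (i : Ω) (ψ : A × B × C → ℂ) : (LOCC.announce i).Identifies i ψ :=
  if_pos rfl

lemma identifies_alice [Fintype κ] [Fintype A'] {K : κ → Matrix A' A ℂ}
    {hK : IsMeasurement K} {next : κ → LOCC Ω A' B C}
    (h : ∀ k, (next k).Identifies i (onFst (K k).mulVecLin ψ)) :
    (LOCC.alice κ A' K hK next).Identifies i ψ :=
  (Finset.sum_congr rfl fun k _ => h k).trans (hK.preservesSqNorm.onFst ψ)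

lemma identifies_bob [Fintype κ] [Fintype B'] {K : κ → Matrix B' B ℂ}
    {hK : IsMeasurement K} {next : κ → LOCC Ω A B' C}
    (h : ∀ k, (next k).Identifies i (onSnd (onFst (K k).mulVecLin) ψ)) :
    (LOCC.bob κ B' K hK next).Identifies i ψ :=
  (Finset.sum_congr rfl fun k _ => h k).trans (hK.preservesSqNorm.onFst.onSnd ψ)

lemma identifies_charlie [Fintype κ] [Fintype C'] {K : κ → Matrix C' C ℂ}
    {hK : IsMeasurement K} {next : κ → LOCC Ω A B C'}
    (h : ∀ k, (next k).Identifies i (onSnd (onSnd (K k).mulVecLin) ψ)) :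
    (LOCC.charlie κ C' K hK next).Identifies i ψ :=
  (Finset.sum_congr rfl fun k _ => h k).trans (hK.preservesSqNorm.onSnd.onSnd ψ)

variable [DecidableEq κ] {k₀ : κ}

lemma identifies_restrict {next : κ → LOCC Ω A B C} {f : A × B × C → κ}
    (hf : ∀ x, ψ x ≠ 0 → f x = k₀) (h : (next k₀).Identifies i ψ) (k : κ) :
    (next k).Identifies i fun x => if f x = k then ψ x else 0 := by
  rcases eq_or_ne k k₀ with rfl | hk
  · convert h using 2 with x
    exact ite_eq_left_iff.mpr fun hx => (not_imp_comm.mp (hf x) hx).symm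
  · convert identifies_zero (next k) i using 2 with x
    exact ite_eq_right_iff.mpr fun hx => not_imp_comm.mp (hf x) (hx.trans_ne hk)

variable [Fintype κ]

lemma identifies_alice_value [DecidableEq A] {g : A → κ} {next : κ → LOCC Ω A B C}
    (hg : ∀ x, ψ x ≠ 0 → g x.1 = k₀) (h : (next k₀).Identifies i ψ) :
    (LOCC.alice κ A (valueMeas g) (isMeasurement_valueMeas g) next).Identifies i ψ :=
  identifies_alice fun k => by
    convert identifies_restrict hg h k using 2 with x
    exact valueMeas_mulVec g k _ x.1

lemma identifies_bob_value [DecidableEq B] {g : B → κ} {next : κ → LOCC Ω A B C}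
    (hg : ∀ x, ψ x ≠ 0 → g x.2.1 = k₀) (h : (next k₀).Identifies i ψ) :
    (LOCC.bob κ B (valueMeas g) (isMeasurement_valueMeas g) next).Identifies i ψ :=
  identifies_bob fun k => by
    convert identifies_restrict hg h k using 2 with x
    exact valueMeas_mulVec g k _ x.2.1

lemma identifies_charlie_value [DecidableEq C] {g : C → κ} {next : κ → LOCC Ω A B C}
    (hg : ∀ x, ψ x ≠ 0 → g x.2.2 = k₀) (h : (next k₀).Identifies i ψ) :
    (LOCC.charlie κ C (valueMeas g) (isMeasurement_valueMeas g) next).Identifies i ψ :=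
  identifies_charlie fun k => by
    convert identifies_restrict hg h k using 2 with x
    exact valueMeas_mulVec g k _ x.2.2

variable [DecidableEq A] [DecidableEq B] [DecidableEq C]

/-- The protocol that finds the eigenvalue of the product of three local involutions: each party
measures its own one, and the product of the three signs (that of two signs is `==`) is passed to
`out`. -/
def signProtocol {α : Equiv.Perm A} {β : Equiv.Perm B} {γ : Equiv.Perm C}
    (hα : Function.Involutive α) (hβ : Function.Involutive β) (hγ : Function.Involutive γ)
    (out : Bool → Ω) : LOCC Ω A B C :=
  .alice Bool A (signMeas α) (isMeasurement_signMeas hα) fun t =>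
  .bob Bool B (signMeas β) (isMeasurement_signMeas hβ) fun u =>
  .charlie Bool C (signMeas γ) (isMeasurement_signMeas hγ) fun v =>
  .announce (out ((t == u) == v))

lemma identifies_signProtocol {α : Equiv.Perm A} {β : Equiv.Perm B} {γ : Equiv.Perm C}
    (hα : Function.Involutive α) (hβ : Function.Involutive β) (hγ : Function.Involutive γ)
    {out : Bool → Ω} {s : Bool} (h : ∀ a b c, ψ (α a, β b, γ c) = sgn s * ψ (a, b, c)) :
    (signProtocol hα hβ hγ out).Identifies (out s) ψ := by
  refine identifies_alice fun t => identifies_bob fun u => identifies_charlie fun v => ?_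
  by_cases hs : ((t == u) == v) = s
  · rw [hs]
    exact identifies_announce _ _
  · have eq_zero : onSnd (onSnd (signMeas γ v).mulVecLin)
        (onSnd (onFst (signMeas β u).mulVecLin) (onFst (signMeas α t).mulVecLin ψ)) = 0 := by
      ext ⟨a, b, c⟩
      have h₁ := h (α a) b c
      have h₂ := h a (β b) c
      have h₃ := h a b (γ c)
      rw [hα] at h₁
      rw [hβ] at h₂
      rw [hγ] at h₃
      simp only [onFst, onSnd, LinearMap.coe_mk, AddHom.coe_mk, Matrix.mulVecLin_apply,
        signMeas_mulVec, h, h₁, h₂, h₃, Pi.zero_apply]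
      cases s <;> cases t <;> cases u <;> cases v <;> simp [sgn] at hs ⊢ <;> ring
    rw [eq_zero]
    exact identifies_zero _ _

end Measurements

section GHZProtocol

lemma pm_ne_zero {A : Type} [DecidableEq A] {i j x : A} {s : Bool} (h : pm i j s x ≠ 0) :
    x = i ∨ x = j := by
  contrapose! h
  simp [pm, ket, h]

lemma pm_apply_perm {A : Type} [DecidableEq A] {i j : A} (s : Bool) {σ : Equiv.Perm A}
    (hi : σ i = j) (hj : σ j = i) (x : A) : pm i j s (σ x) = sgn s * pm i j s x := by
  have h₁ : σ x = i ↔ x = j := by rw [← hj, σ.apply_eq_iff_eq]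
  have h₂ : σ x = j ↔ x = i := by rw [← hi, σ.apply_eq_iff_eq]
  cases s <;> simp [pm, ket, Pi.single_apply, h₁, h₂, sgn] <;> ring

lemma pm_apply_swap {A B C : Type} [DecidableEq A] [DecidableEq B] [DecidableEq C] (i j : A × B × C)
    (s : Bool) (x : A × B × C) :
    pm i j s (Equiv.swap i.1 j.1 x.1, Equiv.swap i.2.1 j.2.1 x.2.1, Equiv.swap i.2.2 j.2.2 x.2.2) =
      sgn s * pm i j s x :=
  pm_apply_perm s (σ := (Equiv.swap i.1 j.1).prodCongr
    ((Equiv.swap i.2.1 j.2.1).prodCongr (Equiv.swap i.2.2 j.2.2))) (by ext <;> simp)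
    (by ext <;> simp) x

lemma ghz_eq_pm : ghz = pm (0, 0, 0) (1, 1, 1) true := by
  simp [ghz, pm, sgn]

/-- The outcome of Alice's first measurement: the value of her qubit, flipped unless she is in
state `|p⟩`. Together with this outcome, the qubits of Bob and Charlie tell whether she is. -/
def parityA (x : Fin 4 × Fin 2) : Fin 2 := if x.1 = 0 then x.2 else x.2 + 1

/-- The outcome of Bob's and Charlie's measurement when Alice has announced `f`, so that Alice is
in state `|p⟩` iff the qubit is `f`. -/
def partBC (f : Fin 2) (x : Fin 3 × Fin 2) : Fin 3 :=
  if x.2 ≠ f ∧ x.1 = 0 then 0 else if x.2 = f ∧ x.1 ≠ 2 then 1 else 2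

/-- The pair to which the state belongs when Bob and Charlie have announced `b` and `c` and Alice is
in the basis state `a`. -/
def pairOf (b c : Fin 3) (a : Fin 4) : Fin 7 :=
  if b = 0 then 2 else if b = 1 then 3 else if c = 0 then 5 else if c = 1 then 6
  else if a = 2 then 1 else if a = 3 then 4 else 0

/-- One party's part of the exchange of the basis vectors of the `j`-th pair, of which it holds the
parts `a` and `b`. In the `0`-th pair Alice's being in state `|p⟩` is exchanged too, and hence the
qubits of the resource are flipped. -/
def tileSwap (j : Fin 7) {X : Type} [DecidableEq X] (a b : X) : Equiv.Perm (X × Fin 2) :=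
  (Equiv.swap a b).prodCongr (if j = 0 then Equiv.swap 0 1 else 1)

lemma tileSwap_involutive (j : Fin 7) {X : Type} [DecidableEq X] (a b : X) :
    Function.Involutive (tileSwap j a b) := by
  rintro ⟨x, q⟩
  by_cases hj : j = 0 <;> simp [tileSwap, hj]

lemma exists_outcomes (j : Fin 7) (f : Fin 2) : ∃ b c, ∀ q,
    ∀ y ∈ ({(tile j).1, (tile j).2} : Finset _), parityA (y.1, q) = f →
      partBC f (y.2.1, q) = b ∧ partBC f (y.2.2, q) = c ∧ pairOf b c y.1 = j := by
  revert j f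
  decide

/-- A protocol that identifies the states of `𝔾₃` for sure with the help of `ghz`: they first find
the pair, then its sign. -/
def ghzProtocol : LOCC Label (Fin 4 × Fin 2) (Fin 3 × Fin 2) (Fin 3 × Fin 2) :=
  .alice _ _ (valueMeas parityA) (isMeasurement_valueMeas _) fun f =>
  .bob _ _ (valueMeas (partBC f)) (isMeasurement_valueMeas _) fun b =>
  .charlie _ _ (valueMeas (partBC f)) (isMeasurement_valueMeas _) fun c =>
  .alice _ _ (valueMeas fun x => pairOf b c x.1) (isMeasurement_valueMeas _) fun j =>
  signProtocol (tileSwap_involutive j (tile j).1.1 (tile j).2.1)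
    (tileSwap_involutive j (tile j).1.2.1 (tile j).2.2.1)
    (tileSwap_involutive j (tile j).1.2.2 (tile j).2.2.2) fun s => (j, s)

lemma attach_zeta_ghz_ne_zero {j : Fin 7} {s : Bool} {a : Fin 4} {b c : Fin 3} {q q' q'' : Fin 2}
    (h : attach (zeta (j, s)) ghz ((a, q), (b, q'), (c, q'')) ≠ 0) :
    (a, b, c) ∈ ({(tile j).1, (tile j).2} : Finset _) ∧ q' = q ∧ q'' = q := by
  have hz : zeta (j, s) (a, b, c) ≠ 0 := left_ne_zero_of_mul h
  have hg : ghz (q, q', q'') ≠ 0 := right_ne_zero_of_mul h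
  rw [zeta_eq_pm] at hz
  rw [ghz_eq_pm] at hg
  refine ⟨by simpa using pm_ne_zero hz, ?_⟩
  rcases pm_ne_zero hg with h | h <;> simp_all

lemma attach_zeta_ghz_tileSwap (j : Fin 7) (s : Bool) (a : Fin 4 × Fin 2) (b c : Fin 3 × Fin 2) :
    attach (zeta (j, s)) ghz (tileSwap j (tile j).1.1 (tile j).2.1 a,
      tileSwap j (tile j).1.2.1 (tile j).2.2.1 b, tileSwap j (tile j).1.2.2 (tile j).2.2.2 c) =
        sgn s * attach (zeta (j, s)) ghz (a, b, c) := by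
  have zeta_swap := pm_apply_swap (tile j).1 (tile j).2 s (a.1, b.1, c.1)
  have ghz_flip : ghz (Equiv.swap 0 1 a.2, Equiv.swap 0 1 b.2, Equiv.swap 0 1 c.2) =
      ghz (a.2, b.2, c.2) := by
    rw [ghz_eq_pm]
    exact (pm_apply_swap _ _ true (a.2, b.2, c.2)).trans (one_mul _)
  rw [← zeta_eq_pm] at zeta_swap
  rw [attach_apply, attach_apply, ← mul_assoc, ← zeta_swap]
  by_cases hj : j = 0
  · subst hj
    exact congrArg _ ghz_flip
  · simp [tileSwap, hj]

lemma parityA_tileSwap {j : Fin 7} {y : Fin 4 × Fin 3 × Fin 3}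
    (hy : y ∈ ({(tile j).1, (tile j).2} : Finset _)) (q : Fin 2) :
    parityA (tileSwap j (tile j).1.1 (tile j).2.1 (y.1, q)) = parityA (y.1, q) := by
  revert j y q
  decide

lemma ghzProtocol_identifies (i : Label) : ghzProtocol.Identifies i (attach (zeta i) ghz) := by
  obtain ⟨j, s⟩ := i
  refine identifies_alice fun f => ?_
  obtain ⟨b, c, h⟩ := exists_outcomes j f
  set ψ := onFst (valueMeas parityA f).mulVecLin (attach (zeta (j, s)) ghz)
  have ψ_apply (x) : ψ x = if parityA x.1 = f then attach (zeta (j, s)) ghz x else 0 :=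
    valueMeas_mulVec parityA f (fun a => attach (zeta (j, s)) ghz (a, x.2)) x.1
  have outcomes : ∀ x, ψ x ≠ 0 →
      partBC f x.2.1 = b ∧ partBC f x.2.2 = c ∧ pairOf b c x.1.1 = j := by
    rintro ⟨⟨a, q⟩, ⟨b', q'⟩, c', q''⟩ hx
    rw [ψ_apply, ite_ne_right_iff] at hx
    obtain ⟨hy, rfl, rfl⟩ := attach_zeta_ghz_ne_zero hx.2
    exact h _ _ hy hx.1
  refine identifies_bob_value (fun x hx => (outcomes x hx).1) <|
    identifies_charlie_value (fun x hx => (outcomes x hx).2.1) <|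
    identifies_alice_value (k₀ := j) (fun x hx => (outcomes x hx).2.2) <|
    identifies_signProtocol _ _ _ fun a b c => ?_
  rw [ψ_apply, ψ_apply, attach_zeta_ghz_tileSwap]
  by_cases hx : attach (zeta (j, s)) ghz (a, b, c) = 0
  · simp [hx]
  · rw [parityA_tileSwap (attach_zeta_ghz_ne_zero hx).1, mul_ite, mul_zero]

lemma sum_le_payoff_ghz {p : Label → ℝ} (hp : ∀ i, 0 ≤ p i) : ∑ i, p i ≤ payoff p (proj ghz) := by
  have sqNorm_ghz : sqNorm ghz = 1 := by rw [ghz_eq_pm, sqNorm_pm (by decide)]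
  have success_eq (P) : success p (proj ghz) P = ∑ i, p i - failure p P ghz := by
    simpa [sqNorm_ghz] using success_sum_proj p (fun _ : Unit => ghz) P
  have failure_eq_zero : failure p ghzProtocol ghz = 0 :=
    Finset.sum_eq_zero fun i _ => by rw [ghzProtocol_identifies i, sub_self, mul_zero]
  have bddAbove : BddAbove (Set.range (success p (proj ghz))) :=
    ⟨∑ i, p i, Set.forall_mem_range.mpr fun P => by
      linarith [success_eq P, failure_nonneg hp P ghz]⟩
  calc ∑ i, p i = success p (proj ghz) ghzProtocol := by rw [success_eq, failure_eq_zero, sub_zero]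
    _ ≤ payoff p (proj ghz) := le_ciSup bddAbove _

end GHZProtocol

end LSD

end

theorem corollary1_general {D E : Type} [Fintype D] [Fintype E] (p : LSD.Label → ℝ)
    (hp : ∀ i, 0 < p i) {ρ : Matrix (D × E) (D × E) ℂ} (hρ : LSD.IsDensity ρ) :
    LSD.StrictlyBetter p (LSD.proj LSD.ghz) (LSD.sharedAB ρ) ∧
    LSD.StrictlyBetter p (LSD.proj LSD.ghz) (LSD.sharedBC ρ) ∧
    LSD.StrictlyBetter p (LSD.proj LSD.ghz) (LSD.sharedAC ρ) :=
  have le_payoff_ghz := LSD.sum_le_payoff_ghz fun i => (hp i).le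
  ⟨(LSD.payoff_sharedAB_lt hp hρ).trans_le le_payoff_ghz,
    (LSD.payoff_sharedBC_lt hp hρ).trans_le le_payoff_ghz,
    (LSD.payoff_sharedAC_lt hp hρ).trans_le le_payoff_ghz⟩

theorem corollary1 (p : LSD.Label → ℝ) (hp : ∀ i, 0 < p i) (hp1 : ∑ i, p i = 1)
    (d₁ d₂ : ℕ) (ρ : Matrix (Fin d₁ × Fin d₂) (Fin d₁ × Fin d₂) ℂ) (hρ : LSD.IsDensity ρ) :
    LSD.StrictlyBetter p (LSD.proj LSD.ghz) (LSD.sharedAB ρ) ∧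
    LSD.StrictlyBetter p (LSD.proj LSD.ghz) (LSD.sharedBC ρ) ∧
    LSD.StrictlyBetter p (LSD.proj LSD.ghz) (LSD.sharedAC ρ) :=
  corollary1_general p hp hρ
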